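/- Let $F_n$ and $L_n$ be the Fibonacci and Lucas numbers ($F_0=0$, $F_1=1$, $L_0=2$, $L_1=1$, both satisfying $X_n=X_{n-1}+X_{n-2}$ for $n\ge 2$), and let $\alpha=(1+\sqrt5)/2$. If $r$ is a positive integer, then both of the following series converge absolutely, with the stated sums: \begin{align*} \sum_{k=1}^\infty \frac{(-1)^{(r-1)k}\left(\frac{27}{5}\right)^k}{k\binom{3k}{k}F_{3r}^{2k}} &= 2\sqrt{15}\,\frac{F_r}{L_{3r}}\arctan\left(\frac{\sqrt3}{\alpha^r(\alpha^r+L_r)}\right)-(-1)^r\frac{L_r}{L_{3r}}\log\left(\frac{F_{3r}}{5F_r^3}\right),\\ \sum_{k=1}^\infty \frac{(-1)^{rk}\,27^k}{k\binom{3k}{k}L_{3r}^{2k}} &= \frac{2\sqrt{15}}{5}\,\frac{L_r}{F_{3r}}\arctan\left(\frac{\sqrt3}{\alpha^r(\alpha^r+\sqrt5\,F_r)}\right)+(-1)^r\frac{F_r}{F_{3r}}\log\left(\frac{L_{3r}}{L_r^3}\right). \end{align*} -/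

import Mathlib

/-- The Lucas numbers: `L 0 = 2`, `L 1 = 1`, `L (n + 2) = L (n + 1) + L n`. -/
def lucasNum : ℕ → ℕ
  | 0 => 2
  | 1 => 1
  | n + 2 => lucasNum (n + 1) + lucasNum n

/-! As `1 / (k * (3k).choose k)` is a Beta integral, `∑ z^k / (k * (3k).choose k)` sums
geometrically to `∫ z u² / (1 - z u² (1 - u))` over `[0, 1]` (`hasSum_pow_div_mul_choose`). For `z =
27w³ / (1 + w³)²` the cubic denominator factors rationally in `w`, and its quadratic factor has
discriminant `-3` times a square, so partial fractions give a logarithm and an arctangent with `√3`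
(`integral_eq_arctan_add_log`). With `w = b / a` and `ab = e = ±1`, `z = 27e / (a³ + b³)²`. For `a =
φ^r`, Binet's formulas make `a³ + b³` equal to `√5 F_{3r}` when `b = -ψ^r` and `L_{3r}` when `b =
ψ^r`: these are the two series. `HasSum` in `ℝ` is unconditional, so it includes absolute
convergence. -/

/-- The Beta integral at natural number arguments. -/
theorem integral_pow_mul_one_sub_pow (m n : ℕ) :
    ∫ x in (0 : ℝ)..1, x ^ m * (1 - x) ^ n =
      (m.factorial * n.factorial : ℝ) / ((m + n + 1).factorial : ℝ) := by
  induction n generalizing m with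
  | zero =>
    have h : (m.factorial : ℝ) ≠ 0 := by positivity
    have h' : (m : ℝ) + 1 ≠ 0 := by positivity
    simp [Nat.factorial_succ]
    field_simp
  | succ n ih =>
    -- Integration by parts: the boundary terms vanish, and `(m, n + 1)` reduces to `(m + 1, n)`.
    have hd : ∀ x ∈ Set.uIcc (0 : ℝ) 1,
        HasDerivAt (fun x : ℝ => x ^ (m + 1) * (1 - x) ^ (n + 1))
          (((m : ℝ) + 1) * (x ^ m * (1 - x) ^ (n + 1)) -
            ((n : ℝ) + 1) * (x ^ (m + 1) * (1 - x) ^ n)) x := by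
      intro x _
      have h1 := hasDerivAt_pow (m + 1) x
      have h2 := ((hasDerivAt_id x).const_sub 1).pow (n + 1)
      refine (h1.mul h2).congr_deriv ?_
      push_cast
      simp
      ring
    have hint : ∀ a b : ℕ, IntervalIntegrable (fun x : ℝ => x ^ a * (1 - x) ^ b)
        MeasureTheory.volume 0 1 := fun a b => by
      apply Continuous.intervalIntegrable
      fun_prop
    have key := intervalIntegral.integral_eq_sub_of_hasDerivAt hd
      (((hint _ _).const_mul _).sub ((hint _ _).const_mul _))
    rw [intervalIntegral.integral_sub ((hint _ _).const_mul _) ((hint _ _).const_mul _),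
      intervalIntegral.integral_const_mul, intervalIntegral.integral_const_mul, ih] at key
    have hm : (m : ℝ) + 1 ≠ 0 := by positivity
    have hf : ((m + 1 + n + 1).factorial : ℝ) ≠ 0 := by positivity
    have e : m + (n + 1) + 1 = m + 1 + n + 1 := by ring
    rw [e]
    simp only [sub_self, zero_pow (Nat.succ_ne_zero _), mul_zero, zero_mul, sub_zero] at key
    rw [eq_div_iff hf]
    have key' := sub_eq_zero.mp key
    rw [mul_div_assoc', eq_div_iff hf] at key'
    apply mul_left_cancel₀ hm
    rw [← mul_assoc, key', Nat.factorial_succ m, Nat.factorial_succ n]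
    push_cast
    ring

theorem one_div_mul_choose_eq_integral (j : ℕ) :
    1 / (((j + 1 : ℕ) : ℝ) * ((3 * (j + 1)).choose (j + 1) : ℝ)) =
      ∫ x in (0 : ℝ)..1, x ^ (2 * (j + 1)) * (1 - x) ^ j := by
  rw [integral_pow_mul_one_sub_pow, Nat.cast_choose ℝ (by omega : j + 1 ≤ 3 * (j + 1)),
    show 3 * (j + 1) - (j + 1) = 2 * (j + 1) by omega,
    show 2 * (j + 1) + j + 1 = 3 * (j + 1) by ring, Nat.factorial_succ j]
  have h1 : (j.factorial : ℝ) ≠ 0 := by positivity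
  have h2 : ((2 * (j + 1)).factorial : ℝ) ≠ 0 := by positivity
  have h3 : ((3 * (j + 1)).factorial : ℝ) ≠ 0 := by positivity
  have h4 : (j : ℝ) + 1 ≠ 0 := by positivity
  push_cast
  field_simp

/-- The crude bound `u²(1 - u) ≤ u(1 - u) ≤ 1/4` is enough: it gives geometric domination of ratio
`1/2`. -/
theorem abs_mul_sq_mul_one_sub_le {z u : ℝ} (hz : |z| ≤ 2) (hu : u ∈ Set.Icc (0 : ℝ) 1) :
    |z * (u ^ 2 * (1 - u))| ≤ 1 / 2 := by
  obtain ⟨h0, h1⟩ := hu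
  have hp : 0 ≤ u ^ 2 * (1 - u) := mul_nonneg (sq_nonneg _) (by linarith)
  have hq : u ^ 2 * (1 - u) ≤ 1 / 4 := by
    nlinarith [sq_nonneg (u - 1 / 2), mul_nonneg h0 (sub_nonneg.2 h1)]
  rw [abs_mul, abs_of_nonneg hp]
  calc |z| * (u ^ 2 * (1 - u)) ≤ 2 * (1 / 4) := by gcongr
    _ = 1 / 2 := by norm_num

theorem one_sub_mul_sq_mul_one_sub_pos {z u : ℝ} (hz : |z| ≤ 2) (hu : u ∈ Set.Icc (0 : ℝ) 1) :
    0 < 1 - z * (u ^ 2 * (1 - u)) := by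
  linarith [(abs_le.mp (abs_mul_sq_mul_one_sub_le hz hu)).2]

theorem hasSum_pow_div_mul_choose {z : ℝ} (hz : |z| ≤ 2) :
    HasSum (fun j : ℕ => z ^ (j + 1) / (((j + 1 : ℕ) : ℝ) * ((3 * (j + 1)).choose (j + 1) : ℝ)))
      (∫ u in (0 : ℝ)..1, z * u ^ 2 / (1 - z * (u ^ 2 * (1 - u)))) := by
  have hIcc : ∀ u ∈ Set.uIoc (0 : ℝ) 1, u ∈ Set.Icc (0 : ℝ) 1 := fun u hu => by
    rw [Set.uIoc_of_le zero_le_one] at hu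
    exact ⟨hu.1.le, hu.2⟩
  have h := intervalIntegral.hasSum_integral_of_dominated_convergence
    (μ := MeasureTheory.volume) (a := (0 : ℝ)) (b := 1)
    (F := fun (j : ℕ) (u : ℝ) => z * u ^ 2 * (z * (u ^ 2 * (1 - u))) ^ j)
    (f := fun u : ℝ => z * u ^ 2 / (1 - z * (u ^ 2 * (1 - u))))
    (fun j _ => 2 * (1 / 2) ^ j) (fun j => ?_) (fun j => ?_) ?_ ?_ ?_
  · refine h.congr_fun ?_
    intro j
    rw [div_eq_mul_one_div, one_div_mul_choose_eq_integral, ← intervalIntegral.integral_const_mul]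
    congr 1
    ext u
    rw [mul_pow, mul_pow]
    ring
  · apply Continuous.aestronglyMeasurable
    fun_prop
  · refine Filter.Eventually.of_forall fun u hu => ?_
    have hu' := hIcc u hu
    rw [norm_mul, norm_pow, norm_mul, Real.norm_eq_abs, Real.norm_eq_abs, Real.norm_eq_abs]
    have h1 : |u ^ 2| ≤ 1 := by
      rw [abs_of_nonneg (sq_nonneg u)]
      exact pow_le_one₀ hu'.1 hu'.2
    have h2 := abs_mul_sq_mul_one_sub_le hz hu'
    calc |z| * |u ^ 2| * |z * (u ^ 2 * (1 - u))| ^ j ≤ 2 * 1 * (1 / 2) ^ j := by gcongr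
      _ = 2 * (1 / 2) ^ j := by ring
  · exact Filter.Eventually.of_forall fun u _ => summable_geometric_two.mul_left 2
  · exact intervalIntegrable_const
  · refine Filter.Eventually.of_forall fun u hu => ?_
    have h2 := abs_mul_sq_mul_one_sub_le hz (hIcc u hu)
    have h3 : ‖z * (u ^ 2 * (1 - u))‖ < 1 := by
      rw [Real.norm_eq_abs]
      linarith
    rw [div_eq_mul_inv]
    exact (hasSum_geometric_of_norm_lt_one h3).mul_left (z * u ^ 2)

/-! ### Closed form of the integral -/

/-- The hypothesis means `|arctan t| < π/6`, so tripling stays on the principal branch. -/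
theorem three_mul_arctan {t : ℝ} (ht : 3 * t ^ 2 < 1) :
    3 * Real.arctan t = Real.arctan ((3 * t - t ^ 3) / (1 - 3 * t ^ 2)) := by
  have h0 : 0 ≤ t ^ 2 := sq_nonneg t
  have h1 : 0 < 1 - t ^ 2 := by linarith
  have h2 : 1 - 3 * t ^ 2 ≠ 0 := by linarith
  have e1 : (t + t) / (1 - t * t) = 2 * t / (1 - t ^ 2) := by ring
  have e2 : 1 - 2 * t / (1 - t ^ 2) * t = (1 - 3 * t ^ 2) / (1 - t ^ 2) := by
    rw [eq_div_iff h1.ne', sub_mul, mul_right_comm, div_mul_cancel₀ _ h1.ne']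
    ring
  have e3 : 2 * t / (1 - t ^ 2) + t = (3 * t - t ^ 3) / (1 - t ^ 2) := by
    rw [eq_div_iff h1.ne', add_mul, div_mul_cancel₀ _ h1.ne']
    ring
  have h3 : 0 < 1 - 2 * t / (1 - t ^ 2) * t := by
    rw [e2]
    exact div_pos (by linarith) h1
  rw [show 3 * Real.arctan t = Real.arctan t + Real.arctan t + Real.arctan t by ring,
    Real.arctan_add (by rw [← sq]; linarith), e1, Real.arctan_add (by linarith), e2, e3,
    div_div_div_cancel_right₀ h1.ne']

/-- The integral in terms of a factorisation
`1 - z * u ^ 2 * (1 - u) = (1 + c * u) * (1 - c * u + d * u ^ 2)` with real coefficients. -/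
theorem integral_eq_log_add_arctan {z c d δ κ p q : ℝ} (hz : |z| ≤ 2) (hcz : c * d = z)
    (hdz : c ^ 2 - d = z) (hdisc : δ ^ 2 = 4 * d - c ^ 2) (hpq : p + 2 * q = 1)
    (hpqd : p * c ^ 2 = q * d)
    (hκδ : κ * δ / 2 = (q - p) * c) (hc1 : -1 < c) (hc2 : c < 2) :
    ∫ u in (0 : ℝ)..1, z * u ^ 2 / (1 - z * (u ^ 2 * (1 - u))) =
      (p - q) * Real.log (1 + c) + κ * Real.arctan (δ / (2 - c)) := by
  have hL : ∀ u ∈ Set.Icc (0 : ℝ) 1, 0 < 1 + c * u := fun u hu => by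
    nlinarith [hu.1, hu.2]
  have hA : ∀ u ∈ Set.Icc (0 : ℝ) 1, 0 < 2 - c * u := fun u hu => by
    nlinarith [hu.1, hu.2]
  -- Completing the square turns the derivative of the arctangent into a multiple of the reciprocal
  -- of the quadratic factor.
  have hsq : ∀ u, (2 - c * u) ^ 2 + (δ * u) ^ 2 = 4 * (1 - c * u + d * u ^ 2) := fun u => by
    rw [mul_pow, hdisc]
    ring
  have hQ : ∀ u ∈ Set.Icc (0 : ℝ) 1, 0 < 1 - c * u + d * u ^ 2 := fun u hu => by
    have := hsq u
    have := pow_pos (hA u hu) 2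
    have := sq_nonneg (δ * u)
    linarith
  have hderiv : ∀ u ∈ Set.uIcc (0 : ℝ) 1, HasDerivAt
      (fun u : ℝ => p * Real.log (1 + c * u) + q * Real.log (1 - c * u + d * u ^ 2) +
        κ * Real.arctan (δ * u / (2 - c * u)))
      (z * u ^ 2 / (1 - z * (u ^ 2 * (1 - u)))) u := by
    intro u hu
    rw [Set.uIcc_of_le zero_le_one] at hu
    have hL' := (hL u hu).ne'
    have hA' := (hA u hu).ne'
    have hQ' := (hQ u hu).ne'
    have i1 : HasDerivAt (fun u : ℝ => c * u) c u := by
      simpa using (hasDerivAt_id u).const_mul c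
    have i2 : HasDerivAt (fun u : ℝ => d * u ^ 2) (d * (2 * u)) u := by
      simpa using (hasDerivAt_pow 2 u).const_mul d
    have i3 : HasDerivAt (fun u : ℝ => δ * u) δ u := by
      simpa using (hasDerivAt_id u).const_mul δ
    have d1 := ((i1.const_add 1).log hL').const_mul p
    have d2 := (((i1.const_sub 1).add i2).log hQ').const_mul q
    have d3 := ((i3.div (i1.const_sub 2) hA').arctan).const_mul κ
    refine ((d1.add d2).add d3).congr_deriv ?_
    have hfac : 1 - z * (u ^ 2 * (1 - u)) = (1 + c * u) * (1 - c * u + d * u ^ 2) := by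
      linear_combination (u ^ 2) * hdz - u ^ 3 * hcz
    have harc : κ * (1 / (1 + (δ * u / (2 - c * u)) ^ 2) *
        ((δ * (2 - c * u) - δ * u * -c) / (2 - c * u) ^ 2)) =
        (q - p) * c / (1 - c * u + d * u ^ 2) := by
      rw [← hκδ, div_pow, one_add_div (pow_ne_zero 2 hA'), hsq]
      field_simp
      ring
    simp only [Pi.div_apply, Pi.add_apply]
    rw [harc, hfac, ← hcz]
    generalize hQe : 1 - c * u + d * u ^ 2 = Q at hQ' ⊢
    field_simp
    linear_combination (c * d * u ^ 2) * hpq - p * c * hQe - 2 * u * hpqd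
  have hint : IntervalIntegrable (fun u : ℝ => z * u ^ 2 / (1 - z * (u ^ 2 * (1 - u))))
      MeasureTheory.volume 0 1 := by
    apply ContinuousOn.intervalIntegrable
    rw [Set.uIcc_of_le zero_le_one]
    exact ContinuousOn.div (by fun_prop) (by fun_prop)
      fun u hu => (one_sub_mul_sq_mul_one_sub_pos hz hu).ne'
  -- The cubic equals `1` at `u = 1`, so its two factors are inverse there and the logarithms merge.
  have hprod : 1 - c + d = (1 + c)⁻¹ := by
    refine eq_inv_of_mul_eq_one_left ?_
    linear_combination hcz - hdz
  rw [intervalIntegral.integral_eq_sub_of_hasDerivAt hderiv hint]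
  simp only [mul_one, one_pow, mul_zero, zero_div, Real.arctan_zero, add_zero, sub_zero,
    Real.log_one, ne_eq, OfNat.ofNat_ne_zero, not_false_eq_true, zero_pow]
  rw [hprod, Real.log_inv]
  ring

/-- Eliminating `d` gives `z = c³ / (1 + c)`. Taking `c = 3w / (1 - w + w²)` makes `(4d - c²) / 3` a
square, and the resulting arctangent is `3 * arctan (√3 w / (2 - w))`. -/
theorem integral_eq_arctan_add_log {w : ℝ} (hw : |w| ≤ 2 / 5)
    (hz : |27 * w ^ 3 / (1 + w ^ 3) ^ 2| ≤ 2) :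
    ∫ u in (0 : ℝ)..1, (27 * w ^ 3 / (1 + w ^ 3) ^ 2) * u ^ 2 /
        (1 - (27 * w ^ 3 / (1 + w ^ 3) ^ 2) * (u ^ 2 * (1 - u))) =
      2 * √3 * (w * (1 + w) / (1 - w ^ 3)) * Real.arctan (√3 * w / (2 - w)) +
        w * (1 - w) / (1 - w ^ 3) * Real.log ((1 + w ^ 3) / (1 + w) ^ 3) := by
  obtain ⟨hwl, hwu⟩ := abs_le.mp hw
  have h3 : √3 ^ 2 = 3 := Real.sq_sqrt (by norm_num)
  have hs : 0 < 1 - w + w ^ 2 := by nlinarith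
  have hs' : 0 < 1 + w + w ^ 2 := by nlinarith
  have hp : 0 < 1 + w := by linarith
  have hm : 0 < 1 - w := by linarith
  have hh : 0 < 1 - 2 * w := by linarith
  have h2w : 0 < 2 - w := by linarith
  have e1 : 1 + w ^ 3 = (1 + w) * (1 - w + w ^ 2) := by ring
  have e2 : 1 - w ^ 3 = (1 - w) * (1 + w + w ^ 2) := by ring
  have e3 : 2 - 3 * w / (1 - w + w ^ 2) = (1 - 2 * w) * (2 - w) / (1 - w + w ^ 2) := by
    field_simp
    ring
  have e4 : 1 + 3 * w / (1 - w + w ^ 2) = (1 + w) ^ 2 / (1 - w + w ^ 2) := by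
    field_simp
    ring
  rw [integral_eq_log_add_arctan (c := 3 * w / (1 - w + w ^ 2))
    (d := 9 * w ^ 2 / ((1 + w) ^ 2 * (1 - w + w ^ 2)))
    (δ := 3 * √3 * w * (1 - w) / ((1 - w + w ^ 2) * (1 + w)))
    (κ := 2 * √3 * (w * (1 + w)) / (3 * (1 - w ^ 3)))
    (p := (1 - w + w ^ 2) / (3 * (1 + w + w ^ 2)))
    (q := (1 + w) ^ 2 / (3 * (1 + w + w ^ 2))) hz]
  · have hT : (√3 * w / (2 - w)) ^ 2 = 3 * w ^ 2 / (2 - w) ^ 2 := by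
      rw [div_pow, mul_pow, h3]
    have hT1 : 1 - 3 * (√3 * w / (2 - w)) ^ 2 =
        4 * (1 - 2 * w) * (1 + w) / (2 - w) ^ 2 := by
      rw [hT]
      field_simp
      ring
    have hT2 : 3 * (√3 * w / (2 - w)) - (√3 * w / (2 - w)) ^ 3 =
        12 * √3 * w * (1 - w) / (2 - w) ^ 3 := by
      rw [pow_succ (√3 * w / (2 - w)) 2, hT]
      field_simp
      ring
    have hpos : 0 < 4 * (1 - 2 * w) * (1 + w) / (2 - w) ^ 2 := by positivity
    have harc : Real.arctan (3 * √3 * w * (1 - w) / ((1 - w + w ^ 2) * (1 + w)) /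
        (2 - 3 * w / (1 - w + w ^ 2))) = 3 * Real.arctan (√3 * w / (2 - w)) := by
      rw [three_mul_arctan (by linarith), hT1, hT2, e3]
      congr 1
      field_simp
      ring
    have hlog : (1 + w ^ 3) / (1 + w) ^ 3 = ((1 + w) ^ 2 / (1 - w + w ^ 2))⁻¹ := by
      rw [e1]
      field_simp
    have hpq : (1 - w + w ^ 2) / (3 * (1 + w + w ^ 2)) - (1 + w) ^ 2 / (3 * (1 + w + w ^ 2)) =
        -(w * (1 - w) / (1 - w ^ 3)) := by
      rw [e2]
      field_simp
      ring
    have hκ : 2 * √3 * (w * (1 + w)) / (3 * (1 - w ^ 3)) * 3 =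
        2 * √3 * (w * (1 + w) / (1 - w ^ 3)) := by
      rw [e2]
      field_simp
    rw [harc, hlog, Real.log_inv, hpq, e4, ← mul_assoc, hκ]
    ring
  · rw [e1]
    field_simp
    ring
  · rw [e1]
    field_simp
    ring
  · rw [div_pow, mul_pow, mul_pow, mul_pow, h3]
    field_simp
    ring
  · field_simp
    ring
  · field_simp
    ring
  · have : 2 * √3 * (w * (1 + w)) / (3 * (1 - w ^ 3)) *
        (3 * √3 * w * (1 - w) / ((1 - w + w ^ 2) * (1 + w))) =
        √3 ^ 2 * (2 * w ^ 2 / ((1 - w + w ^ 2) * (1 + w + w ^ 2))) := by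
      rw [e2]
      field_simp
    rw [this, h3]
    field_simp
    ring
  · have : 0 < (1 + w) ^ 2 / (1 - w + w ^ 2) := by positivity
    linarith
  · have : 0 < (1 - 2 * w) * (2 - w) / (1 - w + w ^ 2) := by positivity
    linarith

theorem hasSum_pow_div_mul_choose_of_parametrization {w : ℝ} (hw : |w| ≤ 2 / 5) :
    HasSum (fun j : ℕ => (27 * w ^ 3 / (1 + w ^ 3) ^ 2) ^ (j + 1) /
        (((j + 1 : ℕ) : ℝ) * ((3 * (j + 1)).choose (j + 1) : ℝ)))
      (2 * √3 * (w * (1 + w) / (1 - w ^ 3)) * Real.arctan (√3 * w / (2 - w)) +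
        w * (1 - w) / (1 - w ^ 3) * Real.log ((1 + w ^ 3) / (1 + w) ^ 3)) := by
  -- At `|w| = 2/5` the quotient is at most `1.728 / 0.936² < 2`.
  have hz : |27 * w ^ 3 / (1 + w ^ 3) ^ 2| ≤ 2 := by
    have h3 : |w ^ 3| ≤ 8 / 125 := by
      rw [abs_pow]
      calc |w| ^ 3 ≤ (2 / 5) ^ 3 := by gcongr
        _ = 8 / 125 := by norm_num
    have h3' := abs_le.mp h3
    rw [abs_div, abs_mul, abs_of_pos (by norm_num : (0 : ℝ) < 27),
      abs_of_nonneg (by positivity : 0 ≤ (1 + w ^ 3) ^ 2), div_le_iff₀ (by nlinarith)]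
    nlinarith
  rw [← integral_eq_arctan_add_log hw hz]
  exact hasSum_pow_div_mul_choose hz

/-! ### Specialisation to Fibonacci and Lucas numbers -/

theorem lucasNum_eq (n : ℕ) :
    (lucasNum n : ℝ) = Real.goldenRatio ^ n + Real.goldenConj ^ n := by
  induction n using Nat.twoStepInduction with
  | zero => norm_num [lucasNum]
  | one => simp [lucasNum, Real.goldenRatio_add_goldenConj]
  | more n ih1 ih2 =>
    rw [lucasNum, Nat.cast_add, ih1, ih2]
    linear_combination -(Real.goldenRatio ^ n) * Real.goldenRatio_sq -
      (Real.goldenConj ^ n) * Real.goldenConj_sq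

theorem arctan_sqrt_three_div {a b e : ℝ} (ha : a ≠ 0) (he : e = 1 ∨ e = -1) (hab : a * b = e) :
    Real.arctan (√3 * (b / a) / (2 - b / a)) = e * Real.arctan (√3 / (a * (2 * a - b))) := by
  have h : √3 * (b / a) / (2 - b / a) = e * (√3 / (a * (2 * a - b))) := by
    rw [← hab]
    have h2 : 2 - b / a = (2 * a - b) / a := by field_simp
    rw [h2]
    -- If the denominator vanishes, both sides are `0` because `x / 0 = 0`.
    by_cases h3 : 2 * a - b = 0
    · simp [h3]
    · field_simp
  rw [h]
  rcases he with rfl | rfl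
  · simp
  · simp [Real.arctan_neg]

/-- `(a, b)` is specialised below to `(φ ^ r, ψ ^ r)` and `(φ ^ r, -ψ ^ r)`. -/
theorem hasSum_of_mul_eq_sign {a b e : ℝ} (ha : 0 < a) (he : e = 1 ∨ e = -1) (hab : a * b = e)
    (ha2 : 5 / 2 ≤ a ^ 2) :
    HasSum (fun j : ℕ => (27 * e / (a ^ 3 + b ^ 3) ^ 2) ^ (j + 1) /
        (((j + 1 : ℕ) : ℝ) * ((3 * (j + 1)).choose (j + 1) : ℝ)))
      (2 * √3 * ((a + b) / (a ^ 3 - b ^ 3)) * Real.arctan (√3 / (a * (2 * a - b))) +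
        e * ((a - b) / (a ^ 3 - b ^ 3)) * Real.log ((a ^ 3 + b ^ 3) / (a + b) ^ 3)) := by
  have he2 : e ^ 2 = 1 := by rcases he with rfl | rfl <;> norm_num
  have he0 : e ≠ 0 := by rcases he with rfl | rfl <;> norm_num
  have hb0 : b ≠ 0 := fun h => he0 (by rw [← hab, h, mul_zero])
  have hwe : b / a = e / a ^ 2 := by rw [← hab]; field_simp
  have hw : |b / a| ≤ 2 / 5 := by
    have : |e| = 1 := by rcases he with rfl | rfl <;> norm_num
    rw [hwe, abs_div, this, abs_of_pos (by positivity), div_le_iff₀ (by positivity)]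
    linarith
  have h := hasSum_pow_div_mul_choose_of_parametrization hw
  have hcube : a ^ 3 * b ^ 3 = e := by
    rw [← mul_pow, hab]; linear_combination e * he2
  have hlt := abs_lt.mp (lt_of_le_of_lt hw (by norm_num : (2 / 5 : ℝ) < 1))
  have hba : b < a := by simpa [div_lt_one ha] using hlt.2
  have hba' : 0 < a + b := by
    have := hlt.1
    rw [lt_div_iff₀ ha] at this
    linarith
  have n1 : a ^ 3 - b ^ 3 ≠ 0 := by
    rw [show a ^ 3 - b ^ 3 = (a - b) * (((a + b) ^ 2 + a ^ 2 + b ^ 2) / 2) by ring]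
    have : 0 < a - b := by linarith
    positivity
  have n2 : a ^ 3 + b ^ 3 ≠ 0 := by
    rw [show a ^ 3 + b ^ 3 = (a + b) * (((a - b) ^ 2 + a ^ 2 + b ^ 2) / 2) by ring]
    positivity
  have m1 : 1 - (b / a) ^ 3 = (a ^ 3 - b ^ 3) / a ^ 3 := by field_simp
  have m2 : 1 + (b / a) ^ 3 = (a ^ 3 + b ^ 3) / a ^ 3 := by field_simp
  have m3 : 1 + b / a = (a + b) / a := by field_simp
  have m4 : 1 - b / a = (a - b) / a := by field_simp
  have z1 : 27 * (b / a) ^ 3 / (1 + (b / a) ^ 3) ^ 2 = 27 * e / (a ^ 3 + b ^ 3) ^ 2 := by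
    rw [m2, ← hcube]; field_simp
  have z2 : b / a * (1 + b / a) / (1 - (b / a) ^ 3) = e * ((a + b) / (a ^ 3 - b ^ 3)) := by
    rw [m1, m3, ← hab]; field_simp
  have z3 : b / a * (1 - b / a) / (1 - (b / a) ^ 3) = e * ((a - b) / (a ^ 3 - b ^ 3)) := by
    rw [m1, m4, ← hab]; field_simp
  have z4 : (1 + (b / a) ^ 3) / (1 + b / a) ^ 3 = (a ^ 3 + b ^ 3) / (a + b) ^ 3 := by
    rw [m2, m3]; field_simp
  rw [arctan_sqrt_three_div ha.ne' he hab, z2, z3, z4, z1] at h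
  convert h using 1
  linear_combination (-2 * √3 * ((a + b) / (a ^ 3 - b ^ 3)) *
    Real.arctan (√3 / (a * (2 * a - b)))) * he2

/-- Gives `|b / a| = 1 / a² ≤ 2/5`, the range of the parametrization. -/
theorem five_halves_le_sq_goldenRatio_pow {r : ℕ} (hr : 1 ≤ r) :
    5 / 2 ≤ (Real.goldenRatio ^ r) ^ 2 := by
  have h1 : 3 / 2 ≤ Real.goldenRatio := by
    have : 2 ≤ √5 := Real.le_sqrt_of_sq_le (by norm_num)
    rw [Real.goldenRatio]
    linarith
  calc 5 / 2 ≤ Real.goldenRatio ^ 2 := by rw [Real.goldenRatio_sq]; linarith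
    _ ≤ (Real.goldenRatio ^ 2) ^ r :=
      le_self_pow₀ (one_le_pow₀ Real.one_lt_goldenRatio.le) (by omega)
    _ = (Real.goldenRatio ^ r) ^ 2 := by rw [← pow_mul, ← pow_mul, mul_comm]

theorem corollary5 (r : ℕ) (hr : 1 ≤ r) :
    HasSum
      (fun j : ℕ =>
        let k : ℕ := j + 1
        (-1 : ℝ) ^ ((r - 1) * k) * (27 / 5 : ℝ) ^ k /
          ((k : ℝ) * ((3 * k).choose k : ℝ) * (Nat.fib (3 * r) : ℝ) ^ (2 * k)))
      (2 * Real.sqrt 15 * ((Nat.fib r : ℝ) / (lucasNum (3 * r) : ℝ)) *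
          Real.arctan (Real.sqrt 3 /
            (Real.goldenRatio ^ r * (Real.goldenRatio ^ r + (lucasNum r : ℝ)))) -
        (-1 : ℝ) ^ r * ((lucasNum r : ℝ) / (lucasNum (3 * r) : ℝ)) *
          Real.log ((Nat.fib (3 * r) : ℝ) / (5 * (Nat.fib r : ℝ) ^ 3)))
    ∧
    HasSum
      (fun j : ℕ =>
        let k : ℕ := j + 1
        (-1 : ℝ) ^ (r * k) * (27 : ℝ) ^ k /
          ((k : ℝ) * ((3 * k).choose k : ℝ) * (lucasNum (3 * r) : ℝ) ^ (2 * k)))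
      (2 * Real.sqrt 15 / 5 * ((lucasNum r : ℝ) / (Nat.fib (3 * r) : ℝ)) *
          Real.arctan (Real.sqrt 3 /
            (Real.goldenRatio ^ r *
              (Real.goldenRatio ^ r + Real.sqrt 5 * (Nat.fib r : ℝ)))) +
        (-1 : ℝ) ^ r * ((Nat.fib r : ℝ) / (Nat.fib (3 * r) : ℝ)) *
          Real.log ((lucasNum (3 * r) : ℝ) / (lucasNum r : ℝ) ^ 3)) := by
  set a := Real.goldenRatio ^ r with ha
  set b := Real.goldenConj ^ r with hb
  set e := (-1 : ℝ) ^ r with he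
  have ha0 : 0 < a := pow_pos Real.goldenRatio_pos r
  have he1 : e = 1 ∨ e = -1 := neg_one_pow_eq_or ℝ r
  have he2 : e ^ 2 = 1 := by rcases he1 with h | h <;> rw [h] <;> norm_num
  have hab : a * b = e := by
    rw [ha, hb, ← mul_pow, Real.goldenRatio_mul_goldenConj]
  have ha2 := five_halves_le_sq_goldenRatio_pow hr
  rw [← ha] at ha2
  have h5 : √5 ^ 2 = 5 := Real.sq_sqrt (by norm_num)
  have h50 : √5 ≠ 0 := by positivity
  have h15 : √15 = √3 * √5 := by
    rw [← Real.sqrt_mul (by norm_num)]; norm_num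
  have hF : (Nat.fib r : ℝ) = (a - b) / √5 := Real.coe_fib_eq r
  have hL : (lucasNum r : ℝ) = a + b := lucasNum_eq r
  have hF3 : (Nat.fib (3 * r) : ℝ) = (a ^ 3 - b ^ 3) / √5 := by
    rw [Real.coe_fib_eq, ha, hb, ← pow_mul, ← pow_mul, mul_comm 3 r]
  have hL3 : (lucasNum (3 * r) : ℝ) = a ^ 3 + b ^ 3 := by
    rw [lucasNum_eq, ha, hb, ← pow_mul, ← pow_mul, mul_comm 3 r]
  have hsign : (-1 : ℝ) ^ (r - 1) = -e := by
    obtain ⟨s, rfl⟩ := Nat.exists_eq_add_of_le' hr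
    rw [he, Nat.add_sub_cancel, pow_succ]
    ring
  rw [hF, hL, hF3, hL3, h15]
  constructor
  -- Replacing `ψ^r` by its negative swaps sums and differences of powers and turns the sign into
  -- `(-1)^(r-1)`.
  · have h := hasSum_of_mul_eq_sign (b := -b) (e := -e) ha0
      (by rcases he1 with h | h <;> simp [h]) (by rw [← hab]; ring) ha2
    have hbase : (27 / 5 : ℝ) * -e / ((a ^ 3 - b ^ 3) / √5) ^ 2 =
        27 * -e / (a ^ 3 + (-b) ^ 3) ^ 2 := by
      rw [div_pow, h5, show a ^ 3 + (-b) ^ 3 = a ^ 3 - b ^ 3 by ring]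
      field_simp
    have hlog : (a ^ 3 - b ^ 3) / √5 / (5 * ((a - b) / √5) ^ 3) =
        (a ^ 3 + (-b) ^ 3) / (a + -b) ^ 3 := by
      rw [div_pow, show √5 ^ 3 = 5 * √5 by rw [pow_succ, h5],
        show a ^ 3 + (-b) ^ 3 = a ^ 3 - b ^ 3 by ring, ← sub_eq_add_neg]
      field_simp
    convert h using 1
    · ext j
      simp only [pow_mul, hsign]
      rw [← hbase, div_pow (27 / 5 * -e), mul_pow (27 / 5 : ℝ) (-e)]
      field_simp
    · rw [hlog, show a ^ 3 - (-b) ^ 3 = a ^ 3 + b ^ 3 by ring,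
        show 2 * a - -b = a + (a + b) by ring]
      field_simp
      ring
  · have h := hasSum_of_mul_eq_sign ha0 he1 hab ha2
    convert h using 1
    · ext j
      simp only [pow_mul]
      rw [div_pow, mul_pow (27 : ℝ) e, ← he]
      field_simp
    · rw [show a + √5 * ((a - b) / √5) = 2 * a - b by field_simp; ring]
      have hc : ∀ x y : ℝ, x / √5 / (y / √5) = x / y :=
        fun x y => div_div_div_cancel_right₀ h50 x y
      have hc' : 2 * (√3 * √5) / 5 * ((a + b) / ((a ^ 3 - b ^ 3) / √5)) =
          2 * √3 * ((a + b) / (a ^ 3 - b ^ 3)) := by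
        rw [div_div_eq_mul_div]
        linear_combination (2 / 5 * √3 * ((a + b) / (a ^ 3 - b ^ 3))) * h5
      rw [hc, hc']
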